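/- Let $d\in\mathbb N$. For $z=(x,\xi)\in\mathbb R^{2d}$ let $\pi(z)$ be the time-frequency shift on $L^2(\mathbb R^d)$, $\pi(z)f(y)=e^{2\pi i\xi\cdot y}f(y-x)$. Let $\mathcal S^2$ be the space of Hilbert--Schmidt operators on $L^2(\mathbb R^d)$, with inner product $\langle T,S\rangle_{\mathcal S^2}=\operatorname{tr}(TS^*)$ and norm $\|T\|_{\mathcal S^2}=\langle T,T\rangle_{\mathcal S^2}^{1/2}$. For $S,T\in\mathcal S^2$ the polarized Cohen class is the function on double phase space $$Q_ST(w,z)=\langle T,\pi(z)S\pi(w)^*\rangle_{\mathcal S^2},\qquad (w,z)\in\mathbb R^{2d}\times\mathbb R^{2d}=\mathbb R^{4d}.$$ Let $1\le p<\infty$, let $\Delta\subset\mathbb R^{4d}$ be measurable with $0<|\Delta|<\infty$, and let $S\in\mathcal S^2$. Then $\int_\Delta|Q_ST(w,z)|^p\,dz\,dw<\infty$ for every $T\in\mathcal S^2$, and the supremum $$\Lambda=\sup_{T\in\mathcal S^2\setminus\{0\}}\frac{\left(\int_\Delta|Q_ST(w,z)|^p\,dz\,dw\right)^{1/p}}{\|T\|_{\mathcal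 S^2}}$$ is finite and attained by some $T\in\mathcal S^2\setminus\{0\}$. Furthermore, if $S\neq0$, then every normalized maximizing sequence, that is, every sequence $(T_n)_n$ in $\mathcal S^2$ with $\|T_n\|_{\mathcal S^2}=1$ and $\left(\int_\Delta|Q_ST_n(w,z)|^p\,dz\,dw\right)^{1/p}\to\Lambda$, has a subsequence that converges in the norm of $\mathcal S^2$ to a maximizer, i.e. to some $T_0\in\mathcal S^2\setminus\{0\}$ at which the supremum $\Lambda$ is attained. -/

import Mathlib

open MeasureTheory Filter Topology
open scoped ENNReal InnerProductSpace InnerProduct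

noncomputable section

/-! ### Hilbert–Schmidt operators on a complex Hilbert space -/

section HilbertSchmidt

variable (H : Type*) [NormedAddCommGroup H] [InnerProductSpace ℂ H] [CompleteSpace H]

/-- The index set of some fixed orthonormal basis of `H`. -/
def OnbIndex : Set H := Classical.choose (exists_hilbertBasis ℂ H)

/-- A fixed orthonormal basis of `H`. All notions defined through it below are shown to be
independent of the basis. -/
def onb : HilbertBasis (OnbIndex H) ℂ H :=
  Classical.choose (Classical.choose_spec (exists_hilbertBasis ℂ H))

variable {H}

/-- `T ∈ 𝒮²`: `tr (|T|²) = ∑ ‖T eᵢ‖²` is finite. -/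
def IsHilbertSchmidt (T : H →L[ℂ] H) : Prop :=
  Summable fun i => ‖T (onb H i)‖ ^ 2

/-- The Hilbert–Schmidt norm `(tr |T|²)^(1/2) = (∑ ‖T eᵢ‖²)^(1/2)`. -/
def hsNorm (T : H →L[ℂ] H) : ℝ :=
  √(∑' i, ‖T (onb H i)‖ ^ 2)

/-- The trace `∑ ⟨A eᵢ, eᵢ⟩` (Mathlib's inner product is linear in the second variable). -/
def opTrace (A : H →L[ℂ] H) : ℂ :=
  ∑' i, ⟪onb H i, A (onb H i)⟫_ℂ

/-- The Hilbert–Schmidt inner product `⟨T, S⟩ = tr (T S*)`, linear in `T`. -/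
def hsInner (T S : H →L[ℂ] H) : ℂ :=
  opTrace (T ∘L ContinuousLinearMap.adjoint S)

/-! Independence of the orthonormal basis. -/

lemma hs_parseval {ι : Type*} (b : HilbertBasis ι ℂ H) (x : H) :
    ∑' i, ‖⟪b i, x⟫_ℂ‖ₑ ^ 2 = ‖x‖ₑ ^ 2 := by
  have h := (b.hasSum_inner_mul_inner x x).mapL Complex.reCLM
  have h2 : HasSum (fun i => ‖⟪b i, x⟫_ℂ‖ ^ 2) (‖x‖ ^ 2) := by
    convert h using 1
    · funext i
      rw [← inner_conj_symm x (b i), Complex.conj_mul', Complex.reCLM_apply,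
        ← Complex.ofReal_pow, Complex.ofReal_re]
    · simp [inner_self_eq_norm_sq_to_K, ← Complex.ofReal_pow]
  have h3 := ENNReal.ofReal_tsum_of_nonneg (fun i => sq_nonneg _) h2.summable
  rw [h2.tsum_eq] at h3
  simp only [← ofReal_norm, ← ENNReal.ofReal_pow (norm_nonneg _)]
  exact h3.symm

lemma hs_tsum_adjoint {ι κ : Type*} (b : HilbertBasis ι ℂ H) (c : HilbertBasis κ ℂ H)
    (T : H →L[ℂ] H) :
    ∑' i, ‖T (b i)‖ₑ ^ 2 = ∑' j, ‖ContinuousLinearMap.adjoint T (c j)‖ₑ ^ 2 := by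
  simp_rw [← hs_parseval c (T _), ← hs_parseval b (ContinuousLinearMap.adjoint T _)]
  rw [ENNReal.tsum_comm]
  refine tsum_congr fun j => tsum_congr fun i => ?_
  rw [ContinuousLinearMap.adjoint_inner_right, ← ofReal_norm, ← ofReal_norm, norm_inner_symm]

lemma hs_summable_iff {ι F : Type*} [NormedAddCommGroup F] (v : ι → F) :
    Summable (fun i => ‖v i‖ ^ 2) ↔ ∑' i, ‖v i‖ₑ ^ 2 ≠ ∞ := by
  have : (fun i => ‖v i‖ₑ ^ 2) = fun i => ((‖v i‖₊ ^ 2 : NNReal) : ℝ≥0∞) := by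
    funext i; simp [enorm_eq_nnnorm]
  rw [this, ENNReal.tsum_coe_ne_top_iff_summable, ← NNReal.summable_coe]
  simp

lemma hs_tsum_eq {ι F : Type*} [NormedAddCommGroup F] (v : ι → F) :
    ∑' i, ‖v i‖ ^ 2 = (∑' i, ‖v i‖ₑ ^ 2).toReal := by
  rw [ENNReal.tsum_toReal_eq (by intro i; simp)]
  simp

/-- Being Hilbert–Schmidt, and the norm, may be tested on any orthonormal basis. -/
theorem isHilbertSchmidt_iff {ι : Type*} (b : HilbertBasis ι ℂ H) (T : H →L[ℂ] H) :
    IsHilbertSchmidt T ↔ Summable fun i => ‖T (b i)‖ ^ 2 := by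
  unfold IsHilbertSchmidt
  rw [hs_summable_iff, hs_summable_iff, hs_tsum_adjoint (onb H) (onb H), hs_tsum_adjoint b (onb H)]

theorem hsNorm_eq {ι : Type*} (b : HilbertBasis ι ℂ H) (T : H →L[ℂ] H) :
    hsNorm T = √(∑' i, ‖T (b i)‖ ^ 2) := by
  unfold hsNorm
  rw [hs_tsum_eq, hs_tsum_eq, hs_tsum_adjoint (onb H) (onb H), hs_tsum_adjoint b (onb H)]

theorem IsHilbertSchmidt.adjoint {T : H →L[ℂ] H} (hT : IsHilbertSchmidt T) :
    IsHilbertSchmidt (ContinuousLinearMap.adjoint T) := by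
  unfold IsHilbertSchmidt at *
  rw [hs_summable_iff] at *
  rwa [← hs_tsum_adjoint (onb H) (onb H)]

theorem hsNorm_adjoint (T : H →L[ℂ] H) :
    hsNorm (ContinuousLinearMap.adjoint T) = hsNorm T := by
  unfold hsNorm
  rw [hs_tsum_eq, hs_tsum_eq, hs_tsum_adjoint (onb H) (onb H) T]

theorem IsHilbertSchmidt.smul {T : H →L[ℂ] H} (hT : IsHilbertSchmidt T) (c : ℂ) :
    IsHilbertSchmidt (c • T) := by
  unfold IsHilbertSchmidt at *
  simpa [norm_smul, mul_pow] using hT.mul_left (‖c‖ ^ 2)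

theorem hsNorm_smul (c : ℂ) (T : H →L[ℂ] H) : hsNorm (c • T) = ‖c‖ * hsNorm T := by
  simp [hsNorm, norm_smul, mul_pow, tsum_mul_left]

theorem IsHilbertSchmidt.add {S T : H →L[ℂ] H} (hS : IsHilbertSchmidt S)
    (hT : IsHilbertSchmidt T) : IsHilbertSchmidt (S + T) := by
  unfold IsHilbertSchmidt at *
  refine Summable.of_nonneg_of_le (fun i => sq_nonneg _) (fun i => ?_)
    ((hS.add hT).mul_left 2)
  have h := norm_add_le (S (onb H i)) (T (onb H i))
  have h0 := norm_nonneg (S (onb H i) + T (onb H i))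
  simp only [add_apply]
  nlinarith [sq_nonneg (‖S (onb H i)‖ - ‖T (onb H i)‖)]

theorem IsHilbertSchmidt.sub {S T : H →L[ℂ] H} (hS : IsHilbertSchmidt S)
    (hT : IsHilbertSchmidt T) : IsHilbertSchmidt (S - T) := by
  simpa [sub_eq_add_neg] using hS.add (hT.smul (-1))

theorem IsHilbertSchmidt.hasSum {ι : Type*} (b : HilbertBasis ι ℂ H) {T : H →L[ℂ] H}
    (hT : IsHilbertSchmidt T) : HasSum (fun i => ‖T (b i)‖ ^ 2) (hsNorm T ^ 2) := by
  rw [hsNorm_eq b, Real.sq_sqrt (tsum_nonneg fun i => sq_nonneg _)]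
  exact ((isHilbertSchmidt_iff b T).1 hT).hasSum

lemma hs_hasSum_inner {ι : Type*} (b : HilbertBasis ι ℂ H) {A B : H →L[ℂ] H}
    (hA : IsHilbertSchmidt A) (hB : IsHilbertSchmidt B) :
    HasSum (fun i => ⟪A (b i), B (b i)⟫_ℂ)
      (((hsNorm (A + B) : ℂ) ^ 2 - (hsNorm (A - B) : ℂ) ^ 2 +
        ((hsNorm (A - Complex.I • B) : ℂ) ^ 2 - (hsNorm (A + Complex.I • B) : ℂ) ^ 2)
          * Complex.I) / 4) := by
  have key {C : H →L[ℂ] H} (hC : IsHilbertSchmidt C) :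
      HasSum (fun i => (‖C (b i)‖ : ℂ) ^ 2) ((hsNorm C : ℂ) ^ 2) := by
    have := Complex.hasSum_ofReal.2 (hC.hasSum b)
    simpa using this
  have h := (((key (hA.add hB)).sub (key (hA.sub hB))).add
    (((key (hA.sub (hB.smul Complex.I))).sub
      (key (hA.add (hB.smul Complex.I)))).mul_right Complex.I)).div_const 4
  have e : (fun i => ⟪A (b i), B (b i)⟫_ℂ) = fun i =>
      ((‖(A + B) (b i)‖ : ℂ) ^ 2 - (‖(A - B) (b i)‖ : ℂ) ^ 2 +
        ((‖(A - Complex.I • B) (b i)‖ : ℂ) ^ 2 - (‖(A + Complex.I • B) (b i)‖ : ℂ) ^ 2)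
          * Complex.I) / 4 := by
    funext i
    rw [inner_eq_sum_norm_sq_div_four]
    simp
  rw [e]
  exact h

/-- The inner product `tr (T S*)` of two Hilbert–Schmidt operators is an absolutely convergent
sum, computed by any orthonormal basis, and it equals `∑ ⟨T eᵢ, S eᵢ⟩`. -/
theorem hasSum_hsInner {ι : Type*} (b : HilbertBasis ι ℂ H) {T S : H →L[ℂ] H}
    (hT : IsHilbertSchmidt T) (hS : IsHilbertSchmidt S) :
    HasSum (fun i => ⟪S (b i), T (b i)⟫_ℂ) (hsInner T S) := by
  have e : hsInner T S = ∑' i, ⟪ContinuousLinearMap.adjoint T (onb H i),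
      ContinuousLinearMap.adjoint S (onb H i)⟫_ℂ := by
    unfold hsInner opTrace
    simp [ContinuousLinearMap.adjoint_inner_left]
  rw [e, (hs_hasSum_inner (onb H) hT.adjoint hS.adjoint).tsum_eq]
  have h1 : hsNorm (ContinuousLinearMap.adjoint T + ContinuousLinearMap.adjoint S)
      = hsNorm (S + T) := by
    rw [← hsNorm_adjoint (S + T), map_add, add_comm]
  have h2 : hsNorm (ContinuousLinearMap.adjoint T - ContinuousLinearMap.adjoint S)
      = hsNorm (S - T) := by
    have := hsNorm_smul (-1) (ContinuousLinearMap.adjoint T - ContinuousLinearMap.adjoint S)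
    rw [← hsNorm_adjoint (S - T), map_sub]
    simpa using this.symm
  have h3 : hsNorm (ContinuousLinearMap.adjoint T - Complex.I • ContinuousLinearMap.adjoint S)
      = hsNorm (S - Complex.I • T) := by
    have := hsNorm_smul Complex.I
      (ContinuousLinearMap.adjoint T - Complex.I • ContinuousLinearMap.adjoint S)
    rw [Complex.norm_I, one_mul] at this
    rw [← this, ← hsNorm_adjoint (S - _), map_sub, LinearIsometryEquiv.map_smulₛₗ]
    congr 1
    simp [smul_sub, smul_smul, add_comm]
  have h4 : hsNorm (ContinuousLinearMap.adjoint T + Complex.I • ContinuousLinearMap.adjoint S)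
      = hsNorm (S + Complex.I • T) := by
    have := hsNorm_smul (-Complex.I)
      (ContinuousLinearMap.adjoint T + Complex.I • ContinuousLinearMap.adjoint S)
    rw [norm_neg, Complex.norm_I, one_mul] at this
    rw [← this, ← hsNorm_adjoint (S + _), map_add, LinearIsometryEquiv.map_smulₛₗ]
    congr 1
    simp [smul_smul, add_comm]
  rw [h1, h2, h3, h4]
  exact hs_hasSum_inner b hS hT

/-- The series defining `tr (T S*)` converges, to the same value, in every orthonormal basis. -/
theorem hasSum_hsInner_trace {ι : Type*} (b : HilbertBasis ι ℂ H) {T S : H →L[ℂ] H}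
    (hT : IsHilbertSchmidt T) (hS : IsHilbertSchmidt S) :
    HasSum (fun i => ⟪b i, (T ∘L ContinuousLinearMap.adjoint S) (b i)⟫_ℂ) (hsInner T S) := by
  have h := hs_hasSum_inner b hT.adjoint hS.adjoint
  have e : hsInner T S = ∑' i, ⟪ContinuousLinearMap.adjoint T (onb H i),
      ContinuousLinearMap.adjoint S (onb H i)⟫_ℂ := by
    unfold hsInner opTrace
    simp [ContinuousLinearMap.adjoint_inner_left]
  rw [e, (hs_hasSum_inner (onb H) hT.adjoint hS.adjoint).tsum_eq]
  simpa [ContinuousLinearMap.adjoint_inner_left] using h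

/-- The Hilbert–Schmidt norm is the norm of the Hilbert–Schmidt inner product. -/
theorem hsInner_self {T : H →L[ℂ] H} (hT : IsHilbertSchmidt T) :
    hsInner T T = (hsNorm T : ℂ) ^ 2 := by
  have h := hasSum_hsInner (onb H) hT hT
  have h2 := Complex.hasSum_ofReal.2 (hT.hasSum (onb H))
  refine h.unique ?_
  convert h2 using 1
  · funext i; simp [inner_self_eq_norm_sq_to_K]
  · simp

end HilbertSchmidt

/-! ### Time-frequency shifts and the polarized Cohen class -/

/-- The Hilbert space `L²(ℝᵈ)` of complex-valued functions. -/
abbrev L2Space (d : ℕ) : Type := Lp ℂ 2 (volume : Measure (EuclideanSpace ℝ (Fin d)))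

/-- Phase space `ℝ²ᵈ`, with points `z = (x, ξ)`; its `volume` is Lebesgue measure. -/
abbrev PhaseSpace (d : ℕ) : Type := EuclideanSpace ℝ (Fin d) × EuclideanSpace ℝ (Fin d)

/-- `(π(x, ξ) f)(y) = e^{2π i ξ·y} f (y - x)` on functions. -/
def timeFreqShiftFun {d : ℕ} (z : PhaseSpace d) (f : EuclideanSpace ℝ (Fin d) → ℂ)
    (y : EuclideanSpace ℝ (Fin d)) : ℂ :=
  Complex.exp (2 * Real.pi * Complex.I * (⟪z.2, y⟫_ℝ : ℝ)) * f (y - z.1)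

lemma norm_timeFreqShiftFun {d : ℕ} (z : PhaseSpace d) (f : EuclideanSpace ℝ (Fin d) → ℂ)
    (y : EuclideanSpace ℝ (Fin d)) : ‖timeFreqShiftFun z f y‖ = ‖f (y - z.1)‖ := by
  have : (2 * Real.pi * Complex.I * (⟪z.2, y⟫_ℝ : ℝ) : ℂ)
      = ((2 * Real.pi * ⟪z.2, y⟫_ℝ : ℝ) : ℂ) * Complex.I := by push_cast; ring
  rw [timeFreqShiftFun, norm_mul, this, Complex.norm_exp_ofReal_mul_I, one_mul]

lemma memLp_timeFreqShiftFun {d : ℕ} (z : PhaseSpace d)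
    {f : EuclideanSpace ℝ (Fin d) → ℂ} (hf : MemLp f 2 volume) :
    MemLp (timeFreqShiftFun z f) 2 volume := by
  have h := hf.comp_measurePreserving (measurePreserving_sub_right volume z.1)
  refine h.of_le ?_ (ae_of_all _ fun y => (norm_timeFreqShiftFun z f y).le)
  refine AEStronglyMeasurable.mul (Continuous.aestronglyMeasurable ?_) h.1
  fun_prop

lemma timeFreqShiftFun_congr {d : ℕ} (z : PhaseSpace d)
    {f g : EuclideanSpace ℝ (Fin d) → ℂ} (h : f =ᵐ[volume] g) :
    timeFreqShiftFun z f =ᵐ[volume] timeFreqShiftFun z g := by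
  have := (measurePreserving_sub_right volume z.1).quasiMeasurePreserving.ae_eq_comp h
  filter_upwards [this] with y hy
  simp only [Function.comp_apply] at hy
  simp [timeFreqShiftFun, hy]

/-- The time-frequency shift `π(z)` as an isometry of `L²(ℝᵈ)`. -/
def timeFreqShiftIsom {d : ℕ} (z : PhaseSpace d) : L2Space d →ₗᵢ[ℂ] L2Space d where
  toFun f := (memLp_timeFreqShiftFun z (Lp.memLp f)).toLp
  map_add' f g := by
    rw [← MemLp.toLp_add]
    refine MemLp.toLp_congr _ _ ((timeFreqShiftFun_congr z (Lp.coeFn_add f g)).trans ?_)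
    exact ae_of_all _ fun y => by simp [timeFreqShiftFun, mul_add]
  map_smul' c f := by
    rw [RingHom.id_apply, ← MemLp.toLp_const_smul]
    refine MemLp.toLp_congr _ _ ((timeFreqShiftFun_congr z (Lp.coeFn_smul c f)).trans ?_)
    exact ae_of_all _ fun y => by simp [timeFreqShiftFun]; ring
  norm_map' f := by
    change ‖MemLp.toLp _ (memLp_timeFreqShiftFun z (Lp.memLp f))‖ = ‖f‖
    rw [Lp.norm_toLp, Lp.norm_def]
    congr 1
    rw [← eLpNorm_comp_measurePreserving (Lp.aestronglyMeasurable f)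
      (measurePreserving_sub_right volume z.1)]
    exact eLpNorm_congr_norm_ae (ae_of_all _ fun y => norm_timeFreqShiftFun z f y)

/-- The time-frequency shift `π(z)` as a bounded operator on `L²(ℝᵈ)`. -/
def timeFreqShift {d : ℕ} (z : PhaseSpace d) : L2Space d →L[ℂ] L2Space d :=
  (timeFreqShiftIsom z).toContinuousLinearMap

/-- The `γ`-shift `γ_{w,z}(S) = π(z) S π(w)*`. -/
def gammaShift {d : ℕ} (w z : PhaseSpace d) (S : L2Space d →L[ℂ] L2Space d) :
    L2Space d →L[ℂ] L2Space d :=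
  timeFreqShift z ∘L S ∘L ContinuousLinearMap.adjoint (timeFreqShift w)

/-- The polarized Cohen class `Q_S T (w, z) = ⟨T, π(z) S π(w)*⟩`. -/
def polarizedCohen {d : ℕ} (S T : L2Space d →L[ℂ] L2Space d) (w z : PhaseSpace d) : ℂ :=
  hsInner T (gammaShift w z S)

/-! ### The concentration problem -/

/-- The quotient `(∫_Δ |Q_S T(w,z)|^p dz dw)^(1/p) / ‖T‖`. -/
def concentrationQuotient {d : ℕ} (p : ℝ) (Δ : Set (PhaseSpace d × PhaseSpace d))
    (S T : L2Space d →L[ℂ] L2Space d) : ℝ :=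
  (∫ x in Δ, ‖polarizedCohen S T x.1 x.2‖ ^ p) ^ (1 / p) / hsNorm T

/-- The values of the quotient over all nonzero Hilbert–Schmidt operators. -/
def concentrationValues {d : ℕ} (p : ℝ) (Δ : Set (PhaseSpace d × PhaseSpace d))
    (S : L2Space d →L[ℂ] L2Space d) : Set ℝ :=
  {r | ∃ T, IsHilbertSchmidt T ∧ T ≠ 0 ∧ concentrationQuotient p Δ S T = r}

/-- `T` is a nonzero Hilbert–Schmidt operator whose quotient is the largest possible. -/
def IsConcentrationMaximizer {d : ℕ} (p : ℝ) (Δ : Set (PhaseSpace d × PhaseSpace d))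
    (S T : L2Space d →L[ℂ] L2Space d) : Prop :=
  IsHilbertSchmidt T ∧ T ≠ 0 ∧
    IsGreatest (concentrationValues p Δ S) (concentrationQuotient p Δ S T)

/-- Hilbert–Schmidt operators of norm one whose quotients tend to the supremum. -/
def IsNormalizedMaximizingSeq {d : ℕ} (p : ℝ) (Δ : Set (PhaseSpace d × PhaseSpace d))
    (S : L2Space d →L[ℂ] L2Space d) (T : ℕ → L2Space d →L[ℂ] L2Space d) : Prop :=
  (∀ n, IsHilbertSchmidt (T n) ∧ hsNorm (T n) = 1) ∧
    Tendsto (fun n => concentrationQuotient p Δ S (T n)) atTop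
      (𝓝 (sSup (concentrationValues p Δ S)))

end

/-!
For a Hilbert–Schmidt operator `S`, the polarized Cohen class is the transform
`Q_S T (w, z) = ⟪k (w, z), T⟫` of `T` in the Hilbert space `𝒮²`, with the bounded, weakly
measurable kernel `k (w, z) = π(z) S π(w)*`. Existence and compactness of maximizers hold for every
such transform, restricted to a set of finite measure.

A bounded sequence in a separable Hilbert space has a weakly convergent subsequence
(`exists_subseq_tendsto_inner`). Along it the transforms converge pointwise and are dominated by a
constant, so their `L^p(Δ)` norms converge to that of the weak limit (`tendsto_transformNorm`).
For a maximizing sequence of unit vectors the weak limit `v₀` therefore has transform norm `m`,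
the supremum. If `m > 0`, then `m ≤ m ‖v₀‖` and `‖v₀‖ ≤ 1` give `‖v₀‖ = 1`, and weak convergence
without loss of norm is norm convergence (`exists_subseq_tendsto_maximizer`). If `m = 0`, every
nonzero vector is a maximizer. The case `m = 0` is excluded when `S ≠ 0`: by separability all
transforms vanish almost everywhere only if `k = 0` almost everywhere on `Δ`
(`ae_eq_zero_of_forall_transformNorm_eq_zero`), but `π(z)` is injective and `π(w)*` is surjective,
so `π(z) S π(w)*` is never zero (`gammaShift_ne_zero`).

The Hilbert space `𝒮²` is realized as the space of square-summable families of columns `(T eᵢ)ᵢ`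
in an orthonormal basis (`hsColumns`, `exists_hsColumns_eq`). Measurability of the transforms comes
from that of the matrix coefficients `⟪g, π(z) f⟫`, which are integrals depending on a parameter
(`weaklyMeasurable_timeFreqShift`), and from expanding products of operators in the basis
(`WeaklyMeasurable.comp`).
-/

/-! ### Weak sequential compactness in Hilbert spaces -/

section WeakCompactness

variable {E : Type*} [NormedAddCommGroup E] [InnerProductSpace ℂ E]

/-- Sequential Banach–Alaoglu theorem, transported to the Hilbert space itself through the Riesz
isomorphism with its dual. -/
theorem exists_subseq_tendsto_inner [CompleteSpace E] [TopologicalSpace.SeparableSpace E]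
    {v : ℕ → E} {r : ℝ} (hv : ∀ n, ‖v n‖ ≤ r) :
    ∃ φ : ℕ → ℕ, StrictMono φ ∧ ∃ v₀ : E, ‖v₀‖ ≤ r ∧
      ∀ y, Tendsto (fun n => ⟪v (φ n), y⟫_ℂ) atTop (𝓝 ⟪v₀, y⟫_ℂ) := by
  let f : ℕ → WeakDual ℂ E := fun n =>
    StrongDual.toWeakDual (InnerProductSpace.toDual ℂ E (v n))
  have hf : ∀ n, f n ∈
      WeakDual.toStrongDual ⁻¹' Metric.closedBall (0 : StrongDual ℂ E) r := by
    intro n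
    rw [Set.mem_preimage, mem_closedBall_zero_iff]
    exact ((InnerProductSpace.toDual ℂ E).norm_map (v n)).le.trans (hv n)
  obtain ⟨a, ha, φ, hφ, hlim⟩ := WeakDual.isSeqCompact_closedBall ℂ E 0 r hf
  refine ⟨φ, hφ, (InnerProductSpace.toDual ℂ E).symm (WeakDual.toStrongDual a), ?_, fun y => ?_⟩
  · rw [LinearIsometryEquiv.norm_map]
    exact mem_closedBall_zero_iff.1 ha
  · rw [InnerProductSpace.toDual_symm_apply]
    exact ((WeakDual.eval_continuous y).tendsto a).comp hlim

/-- Weak convergence of unit vectors to a unit vector is norm convergence. -/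
theorem tendsto_of_tendsto_inner_of_norm_eq_one {v : ℕ → E} {v₀ : E} (hv : ∀ n, ‖v n‖ = 1)
    (hv₀ : ‖v₀‖ = 1) (h : ∀ y, Tendsto (fun n => ⟪v n, y⟫_ℂ) atTop (𝓝 ⟪v₀, y⟫_ℂ)) :
    Tendsto v atTop (𝓝 v₀) := by
  have h1 : Tendsto (fun n => 2 - 2 * RCLike.re ⟪v n, v₀⟫_ℂ) atTop (𝓝 0) := by
    have := (RCLike.continuous_re.tendsto _).comp (h v₀)
    rw [inner_self_eq_norm_sq, hv₀] at this
    simpa using (this.const_mul 2).const_sub 2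
  have h2 : Tendsto (fun n => ‖v n - v₀‖ ^ 2) atTop (𝓝 0) := by
    refine h1.congr fun n => ?_
    rw [@norm_sub_sq ℂ, hv, hv₀]
    ring
  rw [tendsto_iff_norm_sub_tendsto_zero]
  simpa [Real.sqrt_sq] using h2.sqrt

end WeakCompactness

/-! ### Concentration of a bounded family of functionals -/

section Concentration

variable {E : Type*} [NormedAddCommGroup E] [InnerProductSpace ℂ E]
  {X : Type*} {p C : ℝ} {k : X → E}

theorem norm_inner_rpow_le (hp : 0 < p) (hC : ∀ x, ‖k x‖ ≤ C) {v : E} {r : ℝ} (hv : ‖v‖ ≤ r)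
    (x : X) : ‖⟪k x, v⟫_ℂ‖ ^ p ≤ (C * r) ^ p := by
  refine Real.rpow_le_rpow (norm_nonneg _) ((norm_inner_le_norm _ _).trans ?_) hp.le
  exact mul_le_mul (hC x) hv (norm_nonneg _) ((norm_nonneg _).trans (hC x))

variable [MeasurableSpace X] {μ : Measure X}

/-- The `L^p` norm of the transform `x ↦ ⟪k x, v⟫` of the vector `v`. -/
noncomputable def transformNorm (μ : Measure X) (p : ℝ) (k : X → E) (v : E) : ℝ :=
  (∫ x, ‖⟪k x, v⟫_ℂ‖ ^ p ∂μ) ^ (1 / p)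

theorem transformNorm_nonneg (v : E) : 0 ≤ transformNorm μ p k v :=
  Real.rpow_nonneg (integral_nonneg fun _ => by positivity) _

theorem transformNorm_smul (hp : 0 < p) (c : ℂ) (v : E) :
    transformNorm μ p k (c • v) = ‖c‖ * transformNorm μ p k v := by
  have : ∀ x, ‖⟪k x, c • v⟫_ℂ‖ ^ p = ‖c‖ ^ p * ‖⟪k x, v⟫_ℂ‖ ^ p := fun x => by
    rw [inner_smul_right, norm_mul, Real.mul_rpow (norm_nonneg _) (norm_nonneg _)]
  unfold transformNorm
  simp_rw [this]
  rw [integral_const_mul, Real.mul_rpow (by positivity)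
    (integral_nonneg fun _ => by positivity), ← Real.rpow_mul (norm_nonneg _),
    mul_one_div_cancel hp.ne', Real.rpow_one]

theorem transformNorm_le_sSup_mul_norm (hp : 0 < p)
    (hbdd : BddAbove {r | ∃ v : E, v ≠ 0 ∧ transformNorm μ p k v / ‖v‖ = r}) (v : E) :
    transformNorm μ p k v
      ≤ sSup {r | ∃ v : E, v ≠ 0 ∧ transformNorm μ p k v / ‖v‖ = r} * ‖v‖ := by
  rcases eq_or_ne v 0 with rfl | hv
  · simpa using (transformNorm_smul (μ := μ) (k := k) hp 0 (0 : E)).le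
  · exact (div_le_iff₀ (norm_pos_iff.2 hv)).1 (le_csSup hbdd ⟨v, hv, rfl⟩)

theorem sSup_transformNorm_quotient_pos (hp : 0 < p)
    (hbdd : BddAbove {r | ∃ v : E, v ≠ 0 ∧ transformNorm μ p k v / ‖v‖ = r}) {w : E}
    (hw : transformNorm μ p k w ≠ 0) :
    0 < sSup {r | ∃ v : E, v ≠ 0 ∧ transformNorm μ p k v / ‖v‖ = r} := by
  have h := ((transformNorm_nonneg w).lt_of_ne' hw).trans_le
    (transformNorm_le_sSup_mul_norm hp hbdd w)
  exact pos_of_mul_pos_left h (norm_nonneg w)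

variable [IsFiniteMeasure μ]

theorem integrable_norm_inner_rpow (hp : 0 < p) (hC : ∀ x, ‖k x‖ ≤ C)
    (hk : ∀ v, Measurable fun x => ⟪k x, v⟫_ℂ) (v : E) :
    Integrable (fun x => ‖⟪k x, v⟫_ℂ‖ ^ p) μ := by
  refine Integrable.of_bound (C := (C * ‖v‖) ^ p)
    ((hk v).norm.pow_const p).aestronglyMeasurable (ae_of_all _ fun x => ?_)
  rw [Real.norm_of_nonneg (by positivity)]
  exact norm_inner_rpow_le hp hC le_rfl x

theorem bddAbove_transformNorm_quotient (hp : 0 < p) (hC : ∀ x, ‖k x‖ ≤ C)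
    (hk : ∀ v, Measurable fun x => ⟪k x, v⟫_ℂ) :
    BddAbove {r | ∃ v : E, v ≠ 0 ∧ transformNorm μ p k v / ‖v‖ = r} := by
  refine ⟨(C ^ p * μ.real Set.univ) ^ (1 / p), ?_⟩
  rintro _ ⟨v, hv, rfl⟩
  have hv' : 0 < ‖v‖ := norm_pos_iff.2 hv
  have e : transformNorm μ p k v / ‖v‖ = transformNorm μ p k (((‖v‖⁻¹ : ℝ) : ℂ) • v) := by
    rw [transformNorm_smul hp, Complex.norm_real, norm_inv, norm_norm, div_eq_inv_mul]
  have hn : ‖((‖v‖⁻¹ : ℝ) : ℂ) • v‖ ≤ 1 := by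
    rw [norm_smul, Complex.norm_real, norm_inv, norm_norm, inv_mul_cancel₀ hv'.ne']
  rw [e]
  refine Real.rpow_le_rpow (integral_nonneg fun _ => by positivity) ?_ (by positivity)
  refine (integral_mono (integrable_norm_inner_rpow hp hC hk _) (integrable_const (C ^ p))
    fun x => ?_).trans_eq (by simp [mul_comm])
  simpa using norm_inner_rpow_le hp hC hn x

/-- The transform norm is weakly sequentially continuous on bounded sets: the transforms converge
pointwise and are dominated by a constant, which is integrable as `μ` is finite. -/
theorem tendsto_transformNorm (hp : 0 < p) (hC : ∀ x, ‖k x‖ ≤ C)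
    (hk : ∀ v, Measurable fun x => ⟪k x, v⟫_ℂ) {v : ℕ → E} {v₀ : E} {r : ℝ}
    (hv : ∀ n, ‖v n‖ ≤ r)
    (h : ∀ y, Tendsto (fun n => ⟪v n, y⟫_ℂ) atTop (𝓝 ⟪v₀, y⟫_ℂ)) :
    Tendsto (fun n => transformNorm μ p k (v n)) atTop (𝓝 (transformNorm μ p k v₀)) := by
  refine Tendsto.rpow_const ?_ (Or.inr (by positivity))
  refine tendsto_integral_of_dominated_convergence (fun _ => (C * r) ^ p)
    (fun n => (integrable_norm_inner_rpow hp hC hk _).1) (integrable_const _)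
    (fun n => ae_of_all _ fun x => ?_) (ae_of_all _ fun x => ?_)
  · rw [Real.norm_of_nonneg (by positivity)]
    exact norm_inner_rpow_le hp hC (hv n) x
  · refine Tendsto.rpow_const ?_ (Or.inr hp.le)
    simpa only [norm_inner_symm] using (h (k x)).norm

/-- A maximizing sequence of unit vectors subconverges in norm to a maximizer. The weak limit `v₀`
of a subsequence has transform norm `m`, so `m ≤ m ‖v₀‖`; as `m > 0` no norm is lost in the limit. -/
theorem exists_subseq_tendsto_maximizer [CompleteSpace E] [TopologicalSpace.SeparableSpace E]
    (hp : 0 < p) (hC : ∀ x, ‖k x‖ ≤ C) (hk : ∀ v, Measurable fun x => ⟪k x, v⟫_ℂ)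
    {m : ℝ} (hm : 0 < m) (hmax : ∀ v : E, transformNorm μ p k v ≤ m * ‖v‖)
    {v : ℕ → E} (hv : ∀ n, ‖v n‖ = 1)
    (hlim : Tendsto (fun n => transformNorm μ p k (v n)) atTop (𝓝 m)) :
    ∃ φ : ℕ → ℕ, StrictMono φ ∧ ∃ v₀ : E, ‖v₀‖ = 1 ∧ transformNorm μ p k v₀ = m ∧
      Tendsto (v ∘ φ) atTop (𝓝 v₀) := by
  obtain ⟨φ, hφ, v₀, hv₀, hw⟩ := exists_subseq_tendsto_inner fun n => (hv n).le
  have hF : transformNorm μ p k v₀ = m :=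
    tendsto_nhds_unique (tendsto_transformNorm hp hC hk (fun n => (hv (φ n)).le) hw)
      (hlim.comp hφ.tendsto_atTop)
  have h1 : ‖v₀‖ = 1 := by
    have := hmax v₀
    rw [hF] at this
    nlinarith
  exact ⟨φ, hφ, v₀, h1, hF, tendsto_of_tendsto_inner_of_norm_eq_one (fun n => hv (φ n)) h1 hw⟩

/-- If every transform vanishes almost everywhere then so does the kernel, because countably many
vectors suffice to test whether `k x = 0`. -/
theorem ae_eq_zero_of_forall_transformNorm_eq_zero [TopologicalSpace.SeparableSpace E]
    (hp : 0 < p) (hC : ∀ x, ‖k x‖ ≤ C) (hk : ∀ v, Measurable fun x => ⟪k x, v⟫_ℂ)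
    (h : ∀ v : E, transformNorm μ p k v = 0) : ∀ᵐ x ∂μ, k x = 0 := by
  have h1 : ∀ v : E, ∀ᵐ x ∂μ, ⟪k x, v⟫_ℂ = 0 := fun v => by
    have h0 := (Real.rpow_eq_zero (integral_nonneg fun x => by positivity)
      (one_div_pos.2 hp).ne').1 (h v)
    rw [integral_eq_zero_iff_of_nonneg (fun x => by positivity)
      (integrable_norm_inner_rpow hp hC hk v)] at h0
    filter_upwards [h0] with x hx
    exact norm_eq_zero.1 ((Real.rpow_eq_zero (norm_nonneg _) hp.ne').1 hx)
  obtain ⟨D, hDc, hD⟩ := TopologicalSpace.exists_countable_dense E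
  filter_upwards [(ae_ball_iff hDc).2 fun v _ => h1 v] with x hx
  have : (fun v => ⟪k x, v⟫_ℂ) = fun _ => 0 :=
    Continuous.ext_on hD (by fun_prop) continuous_const hx
  exact inner_self_eq_zero.1 (congrFun this (k x))

/-- The quotient `‖transform of v‖_p / ‖v‖` attains its supremum: if it is not identically zero,
normalizing a maximizing sequence gives a sequence that subconverges to a maximizer. -/
theorem exists_isGreatest_transformNorm_quotient [CompleteSpace E]
    [TopologicalSpace.SeparableSpace E] [Nontrivial E]
    (hp : 0 < p) (hC : ∀ x, ‖k x‖ ≤ C) (hk : ∀ v, Measurable fun x => ⟪k x, v⟫_ℂ) :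
    ∃ v₀ : E, v₀ ≠ 0 ∧ IsGreatest {r | ∃ v : E, v ≠ 0 ∧ transformNorm μ p k v / ‖v‖ = r}
      (transformNorm μ p k v₀ / ‖v₀‖) := by
  set R := {r | ∃ v : E, v ≠ 0 ∧ transformNorm μ p k v / ‖v‖ = r}
  have hbdd : BddAbove R := bddAbove_transformNorm_quotient hp hC hk
  obtain ⟨u, hu⟩ := exists_ne (0 : E)
  by_cases h0 : ∀ v : E, transformNorm μ p k v = 0
  · refine ⟨u, hu, ⟨u, hu, rfl⟩, ?_⟩
    rintro _ ⟨v, -, rfl⟩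
    simp [h0]
  push Not at h0
  obtain ⟨w, hw⟩ := h0
  have hw0 : w ≠ 0 := by
    rintro rfl
    apply hw
    simpa using transformNorm_smul (μ := μ) (k := k) hp 0 (0 : E)
  have hle := transformNorm_le_sSup_mul_norm hp hbdd
  have hm := sSup_transformNorm_quotient_pos hp hbdd hw
  obtain ⟨r, -, hr, hmem⟩ := exists_seq_tendsto_sSup (S := R) ⟨_, w, hw0, rfl⟩ hbdd
  choose v hv hvr using hmem
  have hn : ∀ n, ‖((‖v n‖⁻¹ : ℝ) : ℂ) • v n‖ = 1 := fun n => by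
    rw [norm_smul, Complex.norm_real, norm_inv, norm_norm,
      inv_mul_cancel₀ (norm_ne_zero_iff.2 (hv n))]
  obtain ⟨-, -, v₀, h1, hF, -⟩ := exists_subseq_tendsto_maximizer hp hC hk hm hle hn <| by
    refine hr.congr fun n => ?_
    rw [← hvr, transformNorm_smul hp, Complex.norm_real, norm_inv, norm_norm, div_eq_inv_mul]
  have hv₀ : v₀ ≠ 0 := by
    rintro rfl
    simp at h1
  refine ⟨v₀, hv₀, ⟨v₀, hv₀, rfl⟩, fun r hr => ?_⟩
  rw [hF, h1, div_one]
  exact le_csSup hbdd hr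

end Concentration

/-! ### Hilbert–Schmidt operators as square-summable families of columns -/

section Columns

variable {H : Type*} [NormedAddCommGroup H] [InnerProductSpace ℂ H]

/-- Balls of radius `1 / 2` about the members of an orthonormal family are disjoint, because the
members are at distance `√2` from each other. -/
theorem Orthonormal.countable_index [TopologicalSpace.SeparableSpace H] {ι : Type*} {v : ι → H}
    (hv : Orthonormal ℂ v) : Countable ι := by
  refine Pairwise.countable_of_isOpen_disjoint (s := fun i => Metric.ball (v i) (1 / 2))
    (fun i j hij => ?_) (fun i => Metric.isOpen_ball) (fun i => Metric.nonempty_ball.2 (by simp))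
  refine Metric.ball_disjoint_ball ?_
  have h : ‖v i - v j‖ ^ 2 = 2 := by
    rw [@norm_sub_sq ℂ, hv.1, hv.1, hv.2 hij]
    norm_num
  rw [dist_eq_norm]
  nlinarith [norm_nonneg (v i - v j)]

instance lp_separableSpace {ι : Type*} [Countable ι] [TopologicalSpace.SeparableSpace H] :
    TopologicalSpace.SeparableSpace (lp (fun _ : ι => H) 2) := by
  classical
  let A : Set (lp (fun _ : ι => H) 2) := ⋃ i, Set.range fun x : H => lp.single 2 i x
  have hA : TopologicalSpace.IsSeparable A := by
    refine TopologicalSpace.IsSeparable.iUnion fun i => ?_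
    exact TopologicalSpace.isSeparable_range
      (lp.isometry_single (E := fun _ : ι => H) (p := 2) i).continuous
  rw [← TopologicalSpace.isSeparable_univ_iff]
  refine (hA.span (R := ℂ)).closure.mono fun f _ => ?_
  refine mem_closure_of_tendsto (lp.hasSum_single (by simp) f) (Eventually.of_forall fun s => ?_)
  exact Submodule.sum_mem _ fun i _ =>
    Submodule.subset_span (Set.mem_iUnion.2 ⟨i, Set.mem_range_self _⟩)

theorem HilbertBasis.clm_ext {ι F : Type*} [NormedAddCommGroup F] [NormedSpace ℂ F]
    (b : HilbertBasis ι ℂ H) {A B : H →L[ℂ] F} (h : ∀ i, A (b i) = B (b i)) : A = B := by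
  refine ContinuousLinearMap.ext_on (Submodule.dense_iff_topologicalClosure_eq_top.2 b.dense_span)
    ?_
  rintro _ ⟨i, rfl⟩
  exact h i

variable [CompleteSpace H]

instance onbIndex_countable [TopologicalSpace.SeparableSpace H] : Countable (OnbIndex H) :=
  (onb H).orthonormal.countable_index

/-- The columns `(T eᵢ)ᵢ` of a Hilbert–Schmidt operator in the fixed orthonormal basis. The map
`T ↦ hsColumns T` is an isometric isomorphism of `𝒮²` onto a Hilbert sum of copies of `H`. -/
noncomputable def hsColumns (T : H →L[ℂ] H) (hT : IsHilbertSchmidt T) :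
    lp (fun _ : OnbIndex H => H) 2 :=
  ⟨fun i => T (onb H i), memℓp_gen (by simpa [IsHilbertSchmidt] using hT)⟩

theorem inner_hsColumns {S T : H →L[ℂ] H} (hS : IsHilbertSchmidt S) (hT : IsHilbertSchmidt T) :
    ⟪hsColumns S hS, hsColumns T hT⟫_ℂ = hsInner T S :=
  (lp.hasSum_inner (hsColumns S hS) (hsColumns T hT)).unique (hasSum_hsInner (onb H) hT hS)

theorem norm_hsColumns {T : H →L[ℂ] H} (hT : IsHilbertSchmidt T) :
    ‖hsColumns T hT‖ = hsNorm T := by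
  have h := inner_hsColumns hT hT
  rw [hsInner_self hT, inner_self_eq_norm_sq_to_K] at h
  have h2 : ‖hsColumns T hT‖ ^ 2 = hsNorm T ^ 2 := Complex.ofReal_injective (by simpa using h)
  exact (pow_left_inj₀ (norm_nonneg _) (Real.sqrt_nonneg _) two_ne_zero).1 h2

theorem hsColumns_sub {S T : H →L[ℂ] H} (hS : IsHilbertSchmidt S) (hT : IsHilbertSchmidt T) :
    hsColumns (S - T) (hS.sub hT) = hsColumns S hS - hsColumns T hT := by
  rfl

theorem hsColumns_eq_zero_iff {T : H →L[ℂ] H} (hT : IsHilbertSchmidt T) :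
    hsColumns T hT = 0 ↔ T = 0 := by
  constructor
  · intro h
    refine (onb H).clm_ext fun i => ?_
    have := congrArg (fun f : lp (fun _ : OnbIndex H => H) 2 => f i) h
    simpa [hsColumns] using this
  · rintro rfl
    ext i
    simp [hsColumns]

instance lp_onbIndex_nontrivial [Nontrivial H] : Nontrivial (lp (fun _ : OnbIndex H => H) 2) := by
  classical
  obtain ⟨f, hf⟩ := exists_ne (0 : H)
  have hi : Nonempty (OnbIndex H) := by
    by_contra hne
    rw [not_nonempty_iff] at hne
    refine hf ?_
    simpa using ((onb H).hasSum_repr f).tsum_eq.symm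
  obtain ⟨i⟩ := hi
  refine ⟨lp.single 2 i f, 0, fun h => hf ?_⟩
  simpa using congrArg (fun v : lp (fun _ : OnbIndex H => H) 2 => v i) h

/-- Every square-summable family is the family of columns of the operator
`f ↦ ∑ᵢ ⟪eᵢ, f⟫ vᵢ`, which is bounded by the Cauchy–Schwarz inequality. -/
theorem exists_hsColumns_eq (v : lp (fun _ : OnbIndex H => H) 2) :
    ∃ (T : H →L[ℂ] H) (hT : IsHilbertSchmidt T), hsColumns T hT = v := by
  classical
  have hv : HasSum (fun i => ‖v i‖ ^ (2 : ℝ)) (‖v‖ ^ (2 : ℝ)) := by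
    simpa using lp.hasSum_norm (p := 2) (by norm_num) v
  have hf : ∀ f : H, HasSum (fun i => ‖⟪onb H i, f⟫_ℂ‖ ^ (2 : ℝ)) (‖f‖ ^ (2 : ℝ)) := fun f => by
    have := lp.hasSum_norm (p := 2) (by norm_num) ((onb H).repr f)
    simpa [HilbertBasis.repr_apply_apply] using this
  have hCS : ∀ f : H, Summable (fun i => ‖⟪onb H i, f⟫_ℂ • v i‖) ∧
      ∑' i, ‖⟪onb H i, f⟫_ℂ • v i‖ ≤ ‖v‖ * ‖f‖ := fun f => by
    simp_rw [norm_smul]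
    have h := Real.inner_le_Lp_mul_Lq_hasSum_of_nonneg (p := 2) (q := 2)
      Real.HolderConjugate.two_two (norm_nonneg f) (norm_nonneg v) (fun i => norm_nonneg _)
      (fun i => norm_nonneg _) (hf f) hv
    obtain ⟨c, -, hc, hs⟩ := h
    exact ⟨hs.summable, by rw [hs.tsum_eq, mul_comm]; exact hc⟩
  let L : H →ₗ[ℂ] H :=
    { toFun := fun f => ∑' i, ⟪onb H i, f⟫_ℂ • v i
      map_add' := fun f g => by
        simp_rw [inner_add_right, add_smul]
        exact (hCS f).1.of_norm.tsum_add (hCS g).1.of_norm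
      map_smul' := fun c f => by
        simp_rw [inner_smul_right, mul_smul]
        exact (hCS f).1.of_norm.tsum_const_smul c }
  let T : H →L[ℂ] H := L.mkContinuous ‖v‖ fun f =>
    (norm_tsum_le_tsum_norm (hCS f).1).trans (hCS f).2
  have hT : ∀ i, T (onb H i) = v i := fun i => by
    change ∑' j, ⟪onb H j, onb H i⟫_ℂ • v j = v i
    rw [tsum_eq_single i fun j hj => by rw [(onb H).orthonormal.2 hj, zero_smul]]
    rw [inner_self_eq_norm_sq_to_K, (onb H).orthonormal.1 i]
    simp
  refine ⟨T, ?_, ?_⟩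
  · unfold IsHilbertSchmidt
    simp_rw [hT]
    simpa using hv.summable
  · ext i
    exact hT i

/-! Hilbert–Schmidt operators form a two-sided ideal. -/

theorem IsHilbertSchmidt.comp_left {T : H →L[ℂ] H} (hT : IsHilbertSchmidt T) (A : H →L[ℂ] H) :
    IsHilbertSchmidt (A ∘L T) := by
  unfold IsHilbertSchmidt at *
  refine Summable.of_nonneg_of_le (fun i => sq_nonneg _) (fun i => ?_) (hT.mul_left (‖A‖ ^ 2))
  rw [← mul_pow]
  exact pow_le_pow_left₀ (norm_nonneg _) (A.le_opNorm _) 2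

theorem hsNorm_comp_left_le {T : H →L[ℂ] H} (hT : IsHilbertSchmidt T) {A : H →L[ℂ] H}
    (hA : ‖A‖ ≤ 1) : hsNorm (A ∘L T) ≤ hsNorm T := by
  refine Real.sqrt_le_sqrt ((hT.comp_left A).tsum_le_tsum (fun i => ?_) hT)
  refine pow_le_pow_left₀ (norm_nonneg _) ((A.le_opNorm _).trans ?_) 2
  exact mul_le_of_le_one_left (norm_nonneg _) hA

theorem IsHilbertSchmidt.comp_right {T : H →L[ℂ] H} (hT : IsHilbertSchmidt T) (A : H →L[ℂ] H) :
    IsHilbertSchmidt (T ∘L A) := by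
  have := (hT.adjoint.comp_left (ContinuousLinearMap.adjoint A)).adjoint
  rwa [ContinuousLinearMap.adjoint_comp, ContinuousLinearMap.adjoint_adjoint,
    ContinuousLinearMap.adjoint_adjoint] at this

theorem hsNorm_comp_right_le {T : H →L[ℂ] H} (hT : IsHilbertSchmidt T) {A : H →L[ℂ] H}
    (hA : ‖A‖ ≤ 1) : hsNorm (T ∘L A) ≤ hsNorm T := by
  rw [← hsNorm_adjoint (T ∘L A), ← hsNorm_adjoint T, ContinuousLinearMap.adjoint_comp]
  refine hsNorm_comp_left_le hT.adjoint ?_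
  rwa [LinearIsometryEquiv.norm_map]

end Columns

/-! ### Weakly measurable families of operators -/

section WeakMeasurability

variable {H : Type*} [NormedAddCommGroup H] [InnerProductSpace ℂ H]
  {X : Type*} [MeasurableSpace X]

theorem measurable_of_forall_hasSum {ι : Type*} [Countable ι] {f : ι → X → ℂ} {g : X → ℂ}
    (hf : ∀ i, Measurable (f i)) (h : ∀ x, HasSum (fun i => f i x) (g x)) : Measurable g := by
  refine measurable_of_tendsto_metrizable' (atTop : Filter (Finset ι))
    (fun s => Finset.measurable_sum s fun i _ => hf i) ?_
  rw [tendsto_pi_nhds]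
  intro x
  simpa [HasSum] using h x

/-- A family of operators is weakly measurable if all its matrix coefficients are measurable. -/
def WeaklyMeasurable (A : X → H →L[ℂ] H) : Prop :=
  ∀ f g : H, Measurable fun x => ⟪g, A x f⟫_ℂ

theorem WeaklyMeasurable.const (A : H →L[ℂ] H) : WeaklyMeasurable fun _ : X => A :=
  fun _ _ => measurable_const

variable [CompleteSpace H]

theorem WeaklyMeasurable.adjoint {A : X → H →L[ℂ] H} (hA : WeaklyMeasurable A) :
    WeaklyMeasurable fun x => ContinuousLinearMap.adjoint (A x) := fun f g => by
  simp_rw [ContinuousLinearMap.adjoint_inner_right, ← inner_conj_symm _ f]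
  exact Complex.continuous_conj.measurable.comp (hA g f)

/-- The matrix coefficients of a product are countable sums of products of matrix coefficients. -/
theorem WeaklyMeasurable.comp [TopologicalSpace.SeparableSpace H] {A B : X → H →L[ℂ] H}
    (hA : WeaklyMeasurable A) (hB : WeaklyMeasurable B) :
    WeaklyMeasurable fun x => A x ∘L B x := fun f g => by
  refine measurable_of_forall_hasSum
    (f := fun i x => ⟪g, A x (onb H i)⟫_ℂ * ⟪onb H i, B x f⟫_ℂ)
    (fun i => (hA _ _).mul (hB _ _)) fun x => ?_
  simpa only [ContinuousLinearMap.adjoint_inner_left, ContinuousLinearMap.comp_apply] using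
    (onb H).hasSum_inner_mul_inner (ContinuousLinearMap.adjoint (A x) g) (B x f)

theorem WeaklyMeasurable.measurable_inner_hsColumns [TopologicalSpace.SeparableSpace H]
    {A : X → H →L[ℂ] H} (hA : WeaklyMeasurable A) (hHS : ∀ x, IsHilbertSchmidt (A x))
    (v : lp (fun _ : OnbIndex H => H) 2) :
    Measurable fun x => ⟪hsColumns (A x) (hHS x), v⟫_ℂ := by
  refine measurable_of_forall_hasSum (f := fun i x => ⟪A x (onb H i), v i⟫_ℂ) (fun i => ?_)
    fun x => lp.hasSum_inner (hsColumns (A x) (hHS x)) v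
  simp_rw [← inner_conj_symm _ (v i)]
  exact Complex.continuous_conj.measurable.comp (hA _ _)

end WeakMeasurability

/-! ### Time-frequency shifts of Hilbert–Schmidt operators -/

section TimeFrequency

variable {d : ℕ}

instance l2Space_separableSpace : TopologicalSpace.SeparableSpace (L2Space d) := by
  have : Fact ((2 : ℝ≥0∞) ≠ ⊤) := ⟨by simp⟩
  infer_instance

theorem norm_timeFreqShift_le (z : PhaseSpace d) : ‖timeFreqShift z‖ ≤ 1 :=
  (timeFreqShiftIsom z).norm_toContinuousLinearMap_le

theorem timeFreqShift_injective (z : PhaseSpace d) : Function.Injective (timeFreqShift z) :=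
  (timeFreqShiftIsom z).injective

theorem adjoint_timeFreqShift_surjective (z : PhaseSpace d) :
    Function.Surjective (ContinuousLinearMap.adjoint (timeFreqShift z)) := fun f =>
  ⟨timeFreqShift z f, ext_inner_left ℂ fun g => by
    rw [ContinuousLinearMap.adjoint_inner_right]
    exact (timeFreqShiftIsom z).inner_map_map g f⟩

/-- The matrix coefficient `⟪g, π(z) f⟫` is an integral of a jointly measurable function of `z` and
the integration variable. -/
theorem weaklyMeasurable_timeFreqShift :
    WeaklyMeasurable fun z : PhaseSpace d => timeFreqShift z := fun f g => by
  have hf := (Lp.stronglyMeasurable f).measurable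
  have hg := (Lp.stronglyMeasurable g).measurable
  have h : Measurable (Function.uncurry fun (z : PhaseSpace d) y =>
      ⟪g y, timeFreqShiftFun z f y⟫_ℂ) := by
    have h1 : Measurable fun q : PhaseSpace d × EuclideanSpace ℝ (Fin d) =>
        Complex.exp (2 * Real.pi * Complex.I * (⟪q.1.2, q.2⟫_ℝ : ℝ)) :=
      Continuous.measurable (by fun_prop)
    exact (hg.comp measurable_snd).inner
      (h1.mul (hf.comp (measurable_snd.sub (measurable_fst.comp measurable_fst))))
  convert (h.stronglyMeasurable.integral_prod_right (ν := volume)).measurable using 2 with z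
  rw [L2.inner_def]
  refine integral_congr_ae ?_
  filter_upwards [(memLp_timeFreqShiftFun z (Lp.memLp f)).coeFn_toLp] with y hy
  exact congrArg (fun t => ⟪g y, t⟫_ℂ) hy

theorem weaklyMeasurable_gammaShift (S : L2Space d →L[ℂ] L2Space d) :
    WeaklyMeasurable fun x : PhaseSpace d × PhaseSpace d => gammaShift x.1 x.2 S := by
  have h1 : WeaklyMeasurable fun x : PhaseSpace d × PhaseSpace d => timeFreqShift x.1 :=
    fun f g => (weaklyMeasurable_timeFreqShift f g).comp measurable_fst
  have h2 : WeaklyMeasurable fun x : PhaseSpace d × PhaseSpace d => timeFreqShift x.2 :=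
    fun f g => (weaklyMeasurable_timeFreqShift f g).comp measurable_snd
  exact h2.comp ((WeaklyMeasurable.const S).comp h1.adjoint)

variable {S : L2Space d →L[ℂ] L2Space d}

theorem IsHilbertSchmidt.gammaShift (hS : IsHilbertSchmidt S) (w z : PhaseSpace d) :
    IsHilbertSchmidt (gammaShift w z S) :=
  (hS.comp_right _).comp_left _

theorem hsNorm_gammaShift_le (hS : IsHilbertSchmidt S) (w z : PhaseSpace d) :
    hsNorm (gammaShift w z S) ≤ hsNorm S :=
  (hsNorm_comp_left_le (hS.comp_right _) (norm_timeFreqShift_le z)).trans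
    (hsNorm_comp_right_le hS (by
      rw [LinearIsometryEquiv.norm_map]
      exact norm_timeFreqShift_le w))

theorem gammaShift_ne_zero (hS : S ≠ 0) (w z : PhaseSpace d) : gammaShift w z S ≠ 0 := by
  contrapose! hS
  ext1 f
  obtain ⟨g, rfl⟩ := adjoint_timeFreqShift_surjective w f
  refine timeFreqShift_injective z ?_
  simpa [gammaShift] using congrArg (fun A => A g) hS

instance l2Space_nontrivial : Nontrivial (L2Space d) := by
  have hfin : volume (Metric.ball (0 : EuclideanSpace ℝ (Fin d)) 1) ≠ ⊤ := measure_ball_lt_top.ne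
  refine ⟨indicatorConstLp 2 Metric.isOpen_ball.measurableSet hfin 1, 0, fun h => ?_⟩
  have := congrArg norm h
  rw [norm_indicatorConstLp (by simp) (by simp), norm_zero, norm_one, one_mul] at this
  have h0 := (Real.rpow_eq_zero measureReal_nonneg (by simp)).1 this
  exact (measureReal_ne_zero_iff hfin).2 (Metric.measure_ball_pos _ _ one_pos).ne' h0

end TimeFrequency

/-! ### The concentration problem for the polarized Cohen class -/

section CohenConcentration

variable {d : ℕ} {S T : L2Space d →L[ℂ] L2Space d}

/-- The kernel `(w, z) ↦ π(z) S π(w)*` with values in the Hilbert space of columns. -/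
noncomputable def cohenKernel (hS : IsHilbertSchmidt S) (x : PhaseSpace d × PhaseSpace d) :
    lp (fun _ : OnbIndex (L2Space d) => L2Space d) 2 :=
  hsColumns (gammaShift x.1 x.2 S) (hS.gammaShift x.1 x.2)

theorem norm_cohenKernel_le (hS : IsHilbertSchmidt S) (x : PhaseSpace d × PhaseSpace d) :
    ‖cohenKernel hS x‖ ≤ hsNorm S :=
  (norm_hsColumns _).trans_le (hsNorm_gammaShift_le hS x.1 x.2)

theorem measurable_inner_cohenKernel (hS : IsHilbertSchmidt S)
    (v : lp (fun _ : OnbIndex (L2Space d) => L2Space d) 2) :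
    Measurable fun x => ⟪cohenKernel hS x, v⟫_ℂ :=
  (weaklyMeasurable_gammaShift S).measurable_inner_hsColumns _ v

theorem inner_cohenKernel (hS : IsHilbertSchmidt S) (hT : IsHilbertSchmidt T)
    (x : PhaseSpace d × PhaseSpace d) :
    ⟪cohenKernel hS x, hsColumns T hT⟫_ℂ = polarizedCohen S T x.1 x.2 :=
  inner_hsColumns _ hT

variable {p : ℝ} {Δ : Set (PhaseSpace d × PhaseSpace d)}

theorem concentrationQuotient_eq (hS : IsHilbertSchmidt S) (hT : IsHilbertSchmidt T) :
    concentrationQuotient p Δ S T = transformNorm (volume.restrict Δ) p (cohenKernel hS)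
      (hsColumns T hT) / ‖hsColumns T hT‖ := by
  simp only [concentrationQuotient, transformNorm, inner_cohenKernel, norm_hsColumns]

theorem concentrationValues_eq (hS : IsHilbertSchmidt S) :
    concentrationValues p Δ S = {r | ∃ v : lp (fun _ : OnbIndex (L2Space d) => L2Space d) 2,
      v ≠ 0 ∧ transformNorm (volume.restrict Δ) p (cohenKernel hS) v / ‖v‖ = r} := by
  ext r
  constructor
  · rintro ⟨T, hT, hT0, rfl⟩
    exact ⟨hsColumns T hT, mt (hsColumns_eq_zero_iff hT).1 hT0,
      (concentrationQuotient_eq hS hT).symm⟩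
  · rintro ⟨v, hv, rfl⟩
    obtain ⟨T, hT, rfl⟩ := exists_hsColumns_eq v
    exact ⟨T, hT, mt (hsColumns_eq_zero_iff hT).2 hv, concentrationQuotient_eq hS hT⟩

/-- For `S ≠ 0` and `|Δ| > 0` the supremum is positive: otherwise `π(z) S π(w)*` would vanish for
almost every `(w, z) ∈ Δ`, although it is never zero. -/
theorem exists_transformNorm_cohenKernel_ne_zero (hp : 0 < p) (hS : IsHilbertSchmidt S)
    (hS0 : S ≠ 0) (hΔ_pos : 0 < volume Δ) (hΔ_fin : volume Δ < ⊤) :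
    ∃ v, transformNorm (volume.restrict Δ) p (cohenKernel hS) v ≠ 0 := by
  have : IsFiniteMeasure (volume.restrict Δ) := isFiniteMeasure_restrict.2 hΔ_fin.ne
  by_contra! h
  have hae := ae_eq_zero_of_forall_transformNorm_eq_zero hp (norm_cohenKernel_le hS)
    (measurable_inner_cohenKernel hS) h
  have : NeZero (volume.restrict Δ) := ⟨mt Measure.restrict_eq_zero.1 hΔ_pos.ne'⟩
  obtain ⟨x, hx⟩ := hae.exists
  exact gammaShift_ne_zero hS0 x.1 x.2 ((hsColumns_eq_zero_iff _).1 hx)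

end CohenConcentration

theorem mainTheorem12 (d : ℕ) (p : ℝ) (hp : 1 ≤ p)
    (Δ : Set (PhaseSpace d × PhaseSpace d)) (hΔ : MeasurableSet Δ)
    (hΔ_pos : 0 < volume Δ) (hΔ_fin : volume Δ < ⊤)
    (S : L2Space d →L[ℂ] L2Space d) (hS : IsHilbertSchmidt S) :
    (∀ T : L2Space d →L[ℂ] L2Space d, IsHilbertSchmidt T →
      IntegrableOn (fun x : PhaseSpace d × PhaseSpace d =>
        ‖polarizedCohen S T x.1 x.2‖ ^ p) Δ) ∧
    (∃ T : L2Space d →L[ℂ] L2Space d, IsConcentrationMaximizer p Δ S T) ∧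
    (S ≠ 0 → ∀ T : ℕ → L2Space d →L[ℂ] L2Space d, IsNormalizedMaximizingSeq p Δ S T →
      ∃ φ : ℕ → ℕ, StrictMono φ ∧ ∃ T₀ : L2Space d →L[ℂ] L2Space d,
        IsConcentrationMaximizer p Δ S T₀ ∧
        Tendsto (fun n => hsNorm (T (φ n) - T₀)) atTop (𝓝 0)) := by
  have hp0 : 0 < p := one_pos.trans_le hp
  have : IsFiniteMeasure (volume.restrict Δ) := isFiniteMeasure_restrict.2 hΔ_fin.ne
  have hC := norm_cohenKernel_le hS
  have hk := measurable_inner_cohenKernel hS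
  refine ⟨fun T hT => ?_, ?_, fun hS0 T hT => ?_⟩
  · have := integrable_norm_inner_rpow (μ := volume.restrict Δ) hp0 hC hk (hsColumns T hT)
    simpa only [inner_cohenKernel, IntegrableOn] using this
  · obtain ⟨v₀, hv₀, hmax⟩ := exists_isGreatest_transformNorm_quotient
      (μ := volume.restrict Δ) hp0 hC hk
    obtain ⟨T, hT, rfl⟩ := exists_hsColumns_eq v₀
    refine ⟨T, hT, mt (hsColumns_eq_zero_iff hT).2 hv₀, ?_⟩
    rwa [concentrationValues_eq hS, concentrationQuotient_eq hS hT]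
  · obtain ⟨hT1, hlim⟩ := hT
    obtain ⟨w, hw⟩ := exists_transformNorm_cohenKernel_ne_zero hp0 hS hS0 hΔ_pos hΔ_fin
    have hbdd := bddAbove_transformNorm_quotient (μ := volume.restrict Δ) hp0 hC hk
    rw [concentrationValues_eq hS] at hlim
    set R := {r | ∃ v : lp (fun _ : OnbIndex (L2Space d) => L2Space d) 2,
      v ≠ 0 ∧ transformNorm (volume.restrict Δ) p (cohenKernel hS) v / ‖v‖ = r}
    have hle := transformNorm_le_sSup_mul_norm hp0 hbdd
    have hm := sSup_transformNorm_quotient_pos hp0 hbdd hw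
    have hn : ∀ n, ‖hsColumns (T n) (hT1 n).1‖ = 1 := fun n => by
      rw [norm_hsColumns, (hT1 n).2]
    obtain ⟨φ, hφ, v₀, h1, hF, hv⟩ := exists_subseq_tendsto_maximizer hp0 hC hk hm hle hn <| by
      refine hlim.congr fun n => ?_
      rw [concentrationQuotient_eq hS (hT1 n).1, hn, div_one]
    obtain ⟨T₀, hT₀, rfl⟩ := exists_hsColumns_eq v₀
    have h0 : hsColumns T₀ hT₀ ≠ 0 := norm_ne_zero_iff.1 (h1.trans_ne one_ne_zero)
    refine ⟨φ, hφ, T₀, ⟨hT₀, mt (hsColumns_eq_zero_iff hT₀).2 h0, ?_⟩, ?_⟩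
    · rw [concentrationValues_eq hS, concentrationQuotient_eq hS hT₀]
      refine ⟨⟨_, h0, rfl⟩, fun r hr => ?_⟩
      rw [hF, h1, div_one]
      exact le_csSup hbdd hr
    · refine (tendsto_iff_norm_sub_tendsto_zero.1 hv).congr fun n => ?_
      rw [Function.comp_apply, ← hsColumns_sub, norm_hsColumns]
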